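/- Let $\Pi\colon D\to Z$ be a like-Hermitian vector bundle. That is, $Z$ is a real Banach manifold with a smooth involution $z\mapsto z^{-*}$, $\Pi$ is a smooth vector bundle whose typical fiber is a complex Banach space $\mathcal E$, and there is given a family of sesquilinear strong duality pairings $(\cdot\mid\cdot)_{z,z^{-*}}\colon D_z\times D_{z^{-*}}\to\mathbb C$, $z\in Z$ (continuous, linear in the first and antilinear in the second variable, inducing topological isomorphisms of $D_z$ onto the space of continuous antilinear functionals on $D_{z^{-*}}$, and of the complex conjugate of $D_{z^{-*}}$ onto the dual of $D_z$), such that $\overline{(\xi\mid\eta)_{z,z^{-*}}}=(\eta\mid\xi)_{z^{-*},z}$, and such that $(z,x,y)\mapsto(\Psi(z,x)\mid\Psi'(z^{-*},y))_{z,z^{-*}}$ is smooth for all local trivializations $\Psi,\Psi'$ of $\Pi$. Let $K$ be a reproducing $(-*)$-kernel on $\Pi$: a family of bounded operators $K(s,t)\colon D_t\to D_s$, $s,t\in Z$, such that $\sum_{j,l=1}^n\bigl(K(t_l,t_j^{-*})\eta_j\mid\eta_l\bigr)_{t_l,t_l^{-*}}\ge 0$ for all $n\ge1$, $t_j\in Z$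 and $\eta_j\in D_{t_j^{-*}}$. For $\xi\in D$ let $K_\xi=K(\cdot,\Pi(\xi))\xi$, a section of $\Pi$. Let $\mathcal H^K$ be the Hilbert space completion of $\operatorname{span}\{K_\xi\mid\xi\in D\}$ with respect to the scalar product determined by $(K_\eta\mid K_\xi)_{\mathcal H^K}=(K(s^{-*},t)\eta\mid\xi)_{s^{-*},s}$ for $\xi\in D_s$, $\eta\in D_t$. Put $\widehat K\colon D\to\mathcal H^K$, $\widehat K(\xi)=K_\xi$, and $\zeta_K\colon Z\to\operatorname{Gr}(\mathcal H^K)$, $\zeta_K(s)=\overline{\widehat K(D_s)}$. Here, for a complex Hilbert space $\mathcal H$, $\operatorname{Gr}(\mathcal H)$ is the Grassmannian manifold of all closed linear subspaces of $\mathcal H$ (its topology is the one induced by the operator norm through $\mathcal S\mapsto p_{\mathcal S}$, the orthogonal projection onto $\mathcal S$), and $\mathcal T(\mathcal H)=\{(\mathcal S,x)\in\operatorname{Gr}(\mathcal H)\times\mathcal H\mid x\in\mathcal S\}$ is the total space of the tautological bundle. Let $\Omega=(\gamma,\omega)$ be an involutive morphism on the tautological bundle of $\mathcal H^K$: a smooth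 map $\omega\colon\operatorname{Gr}(\mathcal H^K)\to\operatorname{Gr}(\mathcal H^K)$, $\mathcal S\mapsto\mathcal S^{-*}$, with $(\mathcal S^{-*})^{-*}=\mathcal S$, and surjective linear isometries $\gamma_{\mathcal S}\colon\mathcal S\to\mathcal S^{-*}$ which together form a smooth map $\gamma\colon\mathcal T(\mathcal H^K)\to\mathcal T(\mathcal H^K)$, such that $\gamma_{\mathcal S^{-*}}=(\gamma_{\mathcal S})^{-1}$ and $(\gamma_{\mathcal S_1}x_1\mid\gamma_{\mathcal S_2}x_2)=(x_1\mid x_2)$ for all $x_1\in\mathcal S_1$, $x_2\in\mathcal S_2$. Suppose that $\zeta_K(s^{-*})=\zeta_K(s)^{-*}$ for all $s\in Z$. Endow the tautological bundle with the pairings $(x\mid y)_{\mathcal S,\mathcal S^{-*}}=(x\mid\gamma_{\mathcal S^{-*}}y)_{\mathcal H^K}$. Let $\Delta_K=(\delta_K,\zeta_K)$ be the bundle morphism from $\Pi$ into it given by $\delta_K(\xi)=(\zeta_K(\Pi(\xi)),K_\xi)$; the pull-back by $\Delta_K$ of the kernel $Q(\mathcal S_1,\mathcal S_2)=p_{\mathcal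 S_1}\circ\gamma_{\mathcal S_2}\colon\mathcal S_2\to\mathcal S_1$ is $K$. Assume that: 1. $K$ is continuous as a section of $\operatorname{Hom}(p_2^*\Pi,p_1^*\Pi)\to Z\times Z$, that is, in local trivializations it is continuous as a map into $\mathcal B(\mathcal E)$ with the operator norm; 2. for every $s\in Z$ the operator $K(s,s)\colon D_s\to D_s$ is invertible; 3. $\zeta_K$ is locally similar-valued: every point of $Z$ has a neighborhood $U$ such that for all $s,t\in U$ there is an invertible bounded operator $T$ on $\mathcal H^K$ with $T(\zeta_K(s))=\zeta_K(t)$. Then $\Delta_K$ is continuous, that is, both $\delta_K\colon D\to\mathcal T(\mathcal H^K)$ and $\zeta_K\colon Z\to\operatorname{Gr}(\mathcal H^K)$ are continuous. -/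

import Mathlib

open Bundle Set Topology
open scoped Manifold ContDiff ComplexOrder InnerProductSpace ComplexConjugate

noncomputable section

namespace LikeHermitianBundles

/-! ### Smooth complex vector bundles and like-Hermitian structures -/

section LikeHermitianStructures

/-- A complex vector bundle over a real manifold modelled on `B` is smooth if the coordinate changes
between the trivializations of its atlas, viewed as operator-valued maps, are smooth over `ℝ`. -/
class SmoothComplexVectorBundle (B : Type*) [NormedAddCommGroup B] [NormedSpace ℝ B]
    {Z : Type*} [TopologicalSpace Z] [ChartedSpace B Z]
    (E : Type*) [NormedAddCommGroup E] [NormedSpace ℂ E]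
    (V : Z → Type*) [∀ z, AddCommGroup (V z)] [∀ z, Module ℂ (V z)] [∀ z, TopologicalSpace (V z)]
    [TopologicalSpace (TotalSpace E V)] [FiberBundle E V] [VectorBundle ℂ E V] : Prop where
  contMDiffOn_coordChangeL : ∀ (e e' : Trivialization E (TotalSpace.proj : TotalSpace E V → Z))
    [MemTrivializationAtlas e] [MemTrivializationAtlas e'],
    ContMDiffOn 𝓘(ℝ, B) 𝓘(ℝ, E →L[ℂ] E) ∞ (fun z : Z => (e.coordChangeL ℂ e' z : E →L[ℂ] E))
      (e.baseSet ∩ e'.baseSet)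

/-- A sesquilinear form `X × Y → ℂ`, linear in the first and antilinear in the second variable, is a
strong duality pairing if it is continuous and the two induced maps (into the continuous antilinear
functionals on `Y`, and into the continuous linear functionals on `X`) are topological
isomorphisms. -/
structure IsStrongDualityPairing {X Y : Type*} [AddCommGroup X] [Module ℂ X] [TopologicalSpace X]
    [AddCommGroup Y] [Module ℂ Y] [TopologicalSpace Y] (β : X →ₗ[ℂ] Y →ₗ⋆[ℂ] ℂ) : Prop where
  continuous : Continuous fun p : X × Y => β p.1 p.2
  left_iso : ∃ L : X ≃L[ℂ] (Y →L⋆[ℂ] ℂ), ∀ x y, L x y = β x y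
  right_iso : ∃ R : Y ≃L⋆[ℂ] (X →L[ℂ] ℂ), ∀ x y, R y x = β x y

/-- A like-Hermitian structure on a smooth vector bundle: a smooth involution `z ↦ z⁻*` of the base,
written `σ`, and strong duality pairings `(· | ·)_{z, z⁻*}`. To avoid transports along
`σ (σ z) = z`, the pairing between the fibers over `z` and `w` is given for every `w` with
`σ z = w`. -/
structure LikeHermitian (B : Type*) [NormedAddCommGroup B] [NormedSpace ℝ B]
    {Z : Type*} [TopologicalSpace Z] [ChartedSpace B Z]
    (E : Type*) [NormedAddCommGroup E] [NormedSpace ℂ E]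
    (V : Z → Type*) [∀ z, AddCommGroup (V z)] [∀ z, Module ℂ (V z)] [∀ z, TopologicalSpace (V z)]
    [TopologicalSpace (TotalSpace E V)] [FiberBundle E V] [VectorBundle ℂ E V] where
  σ : Z → Z
  invol : ∀ z, σ (σ z) = z
  smooth_σ : ContMDiff 𝓘(ℝ, B) 𝓘(ℝ, B) ∞ σ
  pair : ∀ z w : Z, σ z = w → (V z →ₗ[ℂ] V w →ₗ⋆[ℂ] ℂ)
  strong : ∀ (z w : Z) (h : σ z = w), IsStrongDualityPairing (pair z w h)
  conj_symm : ∀ (z w : Z) (h : σ z = w) (h' : σ w = z) (ξ : V z) (η : V w),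
    conj (pair z w h ξ η) = pair w z h' η ξ
  smooth_pair : ∀ (e e' : Trivialization E (TotalSpace.proj : TotalSpace E V → Z))
    [MemTrivializationAtlas e] [MemTrivializationAtlas e'],
    ContMDiffOn (𝓘(ℝ, B).prod 𝓘(ℝ, E × E)) 𝓘(ℝ, ℂ) ∞
      (fun p : Z × (E × E) => pair p.1 (σ p.1) rfl (e.symm p.1 p.2.1) (e'.symm (σ p.1) p.2.2))
      ((e.baseSet ∩ σ ⁻¹' e'.baseSet) ×ˢ univ)

end LikeHermitianStructures

/-! ### Reproducing kernels and their Hilbert spaces -/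

section Kernels

variable {B : Type*} [NormedAddCommGroup B] [NormedSpace ℝ B]
  {Z : Type*} [TopologicalSpace Z] [ChartedSpace B Z]
  {E : Type*} [NormedAddCommGroup E] [NormedSpace ℂ E]
  {V : Z → Type*} [∀ z, AddCommGroup (V z)] [∀ z, Module ℂ (V z)] [∀ z, TopologicalSpace (V z)]
  [TopologicalSpace (TotalSpace E V)] [FiberBundle E V] [VectorBundle ℂ E V]

/-- A reproducing `(-*)`-kernel: bounded operators `K(s,t) : V t → V s` such that
`∑ (K(t_l, t_j⁻*) η_j | η_l)_{t_l, t_l⁻*} ≥ 0` for all `t_j` and `η_j` in the fiber over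
`s_j = t_j⁻*`. (For complex numbers, `0 ≤ w` means that `w` is real and nonnegative.) -/
structure ReproducingKernel (L : LikeHermitian B E V) where
  op : ∀ s t : Z, V t →L[ℂ] V s
  nonneg : ∀ (n : ℕ) (t s : Fin n → Z) (h : ∀ j, L.σ (t j) = s j) (η : ∀ j, V (s j)),
    0 ≤ ∑ j, ∑ l, L.pair (t l) (s l) (h l) (op (t l) (s j) (η j)) (η l)

variable {L : LikeHermitian B E V}

namespace ReproducingKernel

/-- Continuity of a kernel as a section of `Hom(p₂^* Π, p₁^* Π)`: in local trivializations, it is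
continuous as a map into the bounded operators of the typical fiber with the operator norm. -/
def IsContinuous (K : ReproducingKernel L) : Prop :=
  ∀ (e e' : Trivialization E (TotalSpace.proj : TotalSpace E V → Z))
    [MemTrivializationAtlas e] [MemTrivializationAtlas e'],
    ContinuousOn
      (fun p : Z × Z =>
        ((e.continuousLinearMapAt ℂ p.1).comp (K.op p.1 p.2)).comp (e'.symmL ℂ p.2))
      (e.baseSet ×ˢ e'.baseSet)

variable (K : ReproducingKernel L)

/-- The section `K_ξ = K(·, Π ξ) ξ`. -/
def kerSection (ξ : TotalSpace E V) : ∀ z, V z := fun z => K.op z ξ.1 ξ.2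

/-- The linear span of the sections `K_ξ`. -/
def sectionSpan : Submodule ℂ (∀ z, V z) := Submodule.span ℂ (range K.kerSection)

/-- The span of the sections `K_ξ` as a type of its own, to carry the scalar product of the kernel
(and not the topology of the product of the fibers). -/
def PreRKHS : Type _ := K.sectionSpan

instance : AddCommGroup K.PreRKHS := inferInstanceAs (AddCommGroup K.sectionSpan)
instance : Module ℂ K.PreRKHS := inferInstanceAs (Module ℂ K.sectionSpan)

/-- `f ↦ (f(s⁻*) | ξ)_{s⁻*, s}` for `ξ` in the fiber over `s`; it will be the scalar product of `f`
with `K_ξ`. -/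
def evalPair (L : LikeHermitian B E V) (ξ : TotalSpace E V) : (∀ z, V z) →ₗ[ℂ] ℂ where
  toFun f := L.pair (L.σ ξ.1) ξ.1 (L.invol ξ.1) (f (L.σ ξ.1)) ξ.2
  map_add' f g := by simp
  map_smul' a f := by simp

/-- The scalar `(K(s⁻*, t) η | ξ)_{s⁻*, s}` for `ξ` over `s` and `η` over `t`. -/
def gram (ξ η : TotalSpace E V) : ℂ :=
  L.pair (L.σ ξ.1) ξ.1 (L.invol ξ.1) (K.op (L.σ ξ.1) η.1 η.2) ξ.2

theorem evalPair_kerSection (ξ η : TotalSpace E V) :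
    evalPair L ξ (K.kerSection η) = K.gram ξ η := rfl

theorem gram_sum_nonneg {n : ℕ} (ξ : Fin n → TotalSpace E V) (c : Fin n → ℂ) :
    0 ≤ ∑ j, ∑ l, conj (c l) * c j * K.gram (ξ l) (ξ j) := by
  have h := K.nonneg n (fun j => L.σ (ξ j).1) (fun j => (ξ j).1) (fun j => L.invol _)
    (fun j => c j • (ξ j).2)
  refine h.trans_eq (Finset.sum_congr rfl fun j _ => Finset.sum_congr rfl fun l _ => ?_)
  simp only [map_smul, LinearMap.smul_apply, LinearMap.map_smulₛₗ, smul_eq_mul, gram]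
  ring

theorem gram_conj (ξ η : TotalSpace E V) : conj (K.gram ξ η) = K.gram η ξ := by
  have h (a b : ℂ) := K.gram_sum_nonneg ![ξ, η] ![a, b]
  simp only [Fin.sum_univ_two, Matrix.cons_val_zero, Matrix.cons_val_one] at h
  have h1 := (Complex.nonneg_iff.1 (h 1 0)).2
  have h2 := (Complex.nonneg_iff.1 (h 0 1)).2
  have h3 := (Complex.nonneg_iff.1 (h 1 1)).2
  have h4 := (Complex.nonneg_iff.1 (h 1 Complex.I)).2
  simp at h1 h2 h3 h4
  apply Complex.ext <;> simp <;> linarith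

theorem exists_rep (f : K.PreRKHS) :
    ∃ c : TotalSpace E V →₀ ℂ, c.sum (fun ξ a => a • K.kerSection ξ) = f.1 :=
  (Finsupp.mem_span_range_iff_exists_finsupp).1 f.2

/-- Coefficients of some representation of an element of the span. -/
def rep (f : K.PreRKHS) : TotalSpace E V →₀ ℂ := (K.exists_rep f).choose

theorem rep_spec (f : K.PreRKHS) : (K.rep f).sum (fun ξ a => a • K.kerSection ξ) = f.1 :=
  (K.exists_rep f).choose_spec

/-- The scalar product of `f = ∑ c_ξ K_ξ` and `g`, conjugate-linear in `f`, that is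
`(g | f) = ∑ conj c_ξ (g(s⁻*) | ξ)_{s⁻*, s}`. -/
def innerAux (f g : K.PreRKHS) : ℂ := (K.rep f).sum fun ξ a => conj a * evalPair L ξ g.1

theorem innerAux_eq (f g : K.PreRKHS) : K.innerAux f g =
    (K.rep f).sum fun ξ a => (K.rep g).sum fun η b => conj a * b * K.gram ξ η := by
  unfold innerAux
  refine Finset.sum_congr rfl fun ξ _ => ?_
  dsimp only
  rw [← K.rep_spec g, Finsupp.sum, map_sum, Finset.mul_sum, Finsupp.sum]
  refine Finset.sum_congr rfl fun η _ => ?_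
  rw [map_smul, evalPair_kerSection, smul_eq_mul, mul_assoc]

theorem innerAux_conj (f g : K.PreRKHS) : conj (K.innerAux g f) = K.innerAux f g := by
  rw [innerAux_eq, innerAux_eq]
  simp only [Finsupp.sum, map_sum]
  rw [Finset.sum_comm]
  refine Finset.sum_congr rfl fun ξ _ => Finset.sum_congr rfl fun η _ => ?_
  simp only [map_mul, gram_conj, Complex.conj_conj]
  ring

theorem innerAux_nonneg (f : K.PreRKHS) : 0 ≤ K.innerAux f f := by
  rw [innerAux_eq]
  have h := K.gram_sum_nonneg (fun j => ((K.rep f).support.equivFin.symm j : TotalSpace E V))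
    (fun j => K.rep f ((K.rep f).support.equivFin.symm j))
  refine h.trans_eq ?_
  rw [Finset.sum_comm]
  simp only [Finsupp.sum]
  have hs (F : TotalSpace E V → ℂ) : ∑ j, F ((K.rep f).support.equivFin.symm j) =
      ∑ ξ ∈ (K.rep f).support, F ξ := by
    rw [← Finset.sum_coe_sort (K.rep f).support]
    exact (K.rep f).support.equivFin.symm.sum_comp fun ξ => F ξ
  rw [← hs]
  exact Finset.sum_congr rfl fun j _ => hs fun η =>
    conj (K.rep f ((K.rep f).support.equivFin.symm j)) * K.rep f η *
      K.gram ((K.rep f).support.equivFin.symm j) η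

theorem innerAux_add_right (f g g' : K.PreRKHS) :
    K.innerAux f (g + g') = K.innerAux f g + K.innerAux f g' := by
  have : (g + g').1 = g.1 + g'.1 := rfl
  simp only [innerAux, this, map_add, mul_add, Finsupp.sum, Finset.sum_add_distrib]

theorem innerAux_smul_right (a : ℂ) (f g : K.PreRKHS) :
    K.innerAux f (a • g) = a * K.innerAux f g := by
  have : (a • g).1 = a • g.1 := rfl
  simp only [innerAux, this, map_smul, smul_eq_mul, Finsupp.sum, Finset.mul_sum]
  exact Finset.sum_congr rfl fun ξ _ => by ring

/-- The scalar product on the span of the sections `K_ξ`. -/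
instance core : PreInnerProductSpace.Core ℂ K.PreRKHS where
  inner := K.innerAux
  conj_inner_symm := K.innerAux_conj
  re_inner_nonneg f := (Complex.nonneg_iff.1 (K.innerAux_nonneg f)).1
  add_left f g h := by
    rw [← K.innerAux_conj, innerAux_add_right, map_add, innerAux_conj, innerAux_conj]
  smul_left f g a := by
    rw [← K.innerAux_conj, innerAux_smul_right, map_mul, innerAux_conj]

instance : SeminormedAddCommGroup K.PreRKHS :=
  InnerProductSpace.Core.toSeminormedAddCommGroup (𝕜 := ℂ)

instance : InnerProductSpace ℂ K.PreRKHS := .ofCore _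

/-- The reproducing kernel Hilbert space `ℋ^K`: the completion of the span of the `K_ξ`. -/
abbrev RKHS : Type _ := UniformSpace.Completion K.PreRKHS

/-- `K_ξ` as an element of the span. -/
def preHat (ξ : TotalSpace E V) : K.PreRKHS :=
  ⟨K.kerSection ξ, Submodule.subset_span (mem_range_self ξ)⟩

/-- The map `K̂ : D → ℋ^K`, `ξ ↦ K_ξ`. -/
def hat (ξ : TotalSpace E V) : K.RKHS := (K.preHat ξ : UniformSpace.Completion K.PreRKHS)

/-- The defining formula `(K_η | K_ξ) = (K(s⁻*, t) η | ξ)_{s⁻*, s}` (Mathlib's inner product is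
linear in its second argument). -/
theorem inner_hat (ξ η : TotalSpace E V) : ⟪K.hat ξ, K.hat η⟫_ℂ = K.gram ξ η := by
  rw [hat, hat, UniformSpace.Completion.inner_coe]
  change K.innerAux (K.preHat ξ) (K.preHat η) = _
  have h1 : K.innerAux (K.preHat ξ) (K.preHat η) =
      conj (evalPair L η ((K.rep (K.preHat ξ)).sum fun ζ a => a • K.kerSection ζ)) := by
    simp only [innerAux, Finsupp.sum, map_sum, map_smul, smul_eq_mul, map_mul]
    refine Finset.sum_congr rfl fun ζ _ => ?_
    rw [evalPair_kerSection, gram_conj]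
    rfl
  rw [h1, rep_spec, ← K.gram_conj η ξ]
  rfl

/-- The restriction of `K̂` to a fiber, a bounded linear operator. -/
def hatFiber (s : Z) : V s →L[ℂ] K.RKHS where
  toFun ξ := K.hat ⟨s, ξ⟩
  map_add' ξ η := by
    rw [hat, hat, hat, ← UniformSpace.Completion.coe_add]
    congr 1
    exact Subtype.ext (funext fun z => map_add (K.op z s) ξ η)
  map_smul' a ξ := by
    rw [RingHom.id_apply, hat, hat, ← UniformSpace.Completion.coe_smul]
    congr 1
    exact Subtype.ext (funext fun z => map_smul (K.op z s) a ξ)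
  cont := by
    have hp := (L.strong (L.σ s) s (L.invol s)).continuous
    have hc : Continuous fun p : V s × V s => K.gram ⟨s, p.1⟩ ⟨s, p.2⟩ :=
      hp.comp (((K.op (L.σ s) s).continuous.comp continuous_snd).prodMk continuous_fst)
    rw [continuous_iff_continuousAt]
    intro ξ₀
    have h0 (ξ : V s) : ‖K.hat ⟨s, ξ⟩ - K.hat ⟨s, ξ₀⟩‖ ^ 2 = (K.gram ⟨s, ξ⟩ ⟨s, ξ⟩
        - K.gram ⟨s, ξ⟩ ⟨s, ξ₀⟩ - (K.gram ⟨s, ξ₀⟩ ⟨s, ξ⟩ - K.gram ⟨s, ξ₀⟩ ⟨s, ξ₀⟩)).re := by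
      rw [← K.inner_hat, ← K.inner_hat, ← K.inner_hat, ← K.inner_hat, ← inner_sub_right,
        ← inner_sub_right, ← inner_sub_left]
      exact norm_sq_eq_re_inner (𝕜 := ℂ) _
    have h1 : Continuous fun ξ : V s => ‖K.hat ⟨s, ξ⟩ - K.hat ⟨s, ξ₀⟩‖ ^ 2 := by
      simp only [h0]
      refine Complex.continuous_re.comp (.sub (.sub ?_ ?_) (.sub ?_ ?_))
      · exact hc.comp (continuous_id.prodMk continuous_id)
      · exact hc.comp (continuous_id.prodMk continuous_const)
      · exact hc.comp (continuous_const.prodMk continuous_id)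
      · exact continuous_const
    have h2 := (Real.continuous_sqrt.comp h1).tendsto ξ₀
    simp only [Function.comp_def, Real.sqrt_sq (norm_nonneg _), sub_self, norm_zero,
      zero_pow two_ne_zero, Real.sqrt_zero] at h2
    exact tendsto_iff_norm_sub_tendsto_zero.2 h2

end ReproducingKernel

end Kernels

/-! ### The Grassmannian and its tautological bundle -/

section Grassmannians

variable (H : Type*) [NormedAddCommGroup H] [InnerProductSpace ℂ H] [CompleteSpace H]

/-- The Grassmannian `Gr(ℋ)`: all closed linear subspaces of `ℋ`. -/
def Gr : Type _ := {S : Submodule ℂ H // IsClosed (S : Set H)}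

variable {H}

namespace Gr

/-- The underlying closed subspace. -/
def sub (S : Gr H) : Submodule ℂ H := S.1

instance (S : Gr H) : CompleteSpace S.sub := S.2.completeSpace_coe

/-- The orthogonal projection onto a closed subspace, as a bounded operator on `ℋ`. -/
def proj (S : Gr H) : H →L[ℂ] H := S.sub.starProjection

/-- The topology of the Banach manifold `Gr(ℋ)`, which is the one that the operator norm induces
through `S ↦ p_S`. -/
instance : TopologicalSpace (Gr H) := TopologicalSpace.induced proj inferInstance

/-- The canonical chart of `Gr(ℋ)` at `S`, in the inverse direction: it takes an operator
`X : S → S^⊥` to its graph `{x + X x | x ∈ S}`. -/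
def graph (S : Gr H) (X : S.sub →L[ℂ] S.subᗮ) : Gr H :=
  ⟨(S.subᗮ.subtypeL.comp (X.comp S.sub.orthogonalProjectionOnto)
      - S.subᗮ.starProjection : H →L[ℂ] H).ker, ContinuousLinearMap.isClosed_ker _⟩

theorem add_mem_graph (S : Gr H) (X : S.sub →L[ℂ] S.subᗮ) (x : S.sub) :
    (x + X x : H) ∈ (S.graph X).sub := by
  change (_ : H →L[ℂ] H) (x + X x : H) = 0
  have h1 : S.sub.orthogonalProjectionOnto (x + X x : H) = x := by
    rw [map_add, Submodule.orthogonalProjectionOnto_mem_subspace_eq_self,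
      Submodule.orthogonalProjectionOnto_apply_of_mem_orthogonal (X x).2, add_zero]
  have h2 : S.subᗮ.starProjection (x + X x : H) = X x := by
    rw [map_add, Submodule.starProjection_eq_self_iff.2 (X x).2,
      (Submodule.starProjection_apply_eq_zero_iff _).2 (by simp), zero_add]
  simp [h1, h2]

end Gr

variable (H) in
/-- The total space `𝒯(ℋ)` of the tautological bundle, with the topology of `Gr(ℋ) × ℋ`. -/
abbrev Taut : Type _ := {p : Gr H × H // p.2 ∈ p.1.sub}

/-- Two subspaces of `ℋ` are similar in `ℋ` if an invertible bounded operator of `ℋ` takes one onto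
the other. -/
def Similar (S S' : Gr H) : Prop := ∃ T : H ≃L[ℂ] H, T '' (S.sub : Set H) = S'.sub

/-- A map into the Grassmannian is locally similar-valued if every point has a neighborhood on which
any two values are similar. -/
def LocallySimilar {X : Type*} [TopologicalSpace X] (F : X → Gr H) : Prop :=
  ∀ x, ∃ U ∈ 𝓝 x, ∀ a ∈ U, ∀ b ∈ U, Similar (F a) (F b)

variable (H) in
/-- An involutive morphism `Ω = (γ, ω)`, with `ω` called `base`, on the tautological bundle. Smoothness (over `ℝ`) is
expressed through the charts of `Gr(ℋ)` and `𝒯(ℋ)` at every subspace `S` on the source side, and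
through the embeddings `S ↦ p_S` of `Gr(ℋ)` into the bounded operators and of `𝒯(ℋ)` into
`Gr(ℋ) × ℋ` on the target side. -/
structure InvolutiveMorphism where
  base : Gr H → Gr H
  invol : ∀ S, base (base S) = S
  smooth_base : ∀ S : Gr H, ContDiff ℝ ∞ fun X : S.sub →L[ℂ] S.subᗮ => (base (S.graph X)).proj
  γ : ∀ S : Gr H, S.sub ≃ₗᵢ[ℂ] (base S).sub
  γ_invol : ∀ (S : Gr H) (x : S.sub), (γ (base S) (γ S x) : H) = x
  inner_γ : ∀ (S S' : Gr H) (x : S.sub) (x' : S'.sub), ⟪(γ S x : H), γ S' x'⟫_ℂ = ⟪(x : H), x'⟫_ℂ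
  smooth_γ : ∀ S : Gr H, ContDiff ℝ ∞ fun p : (S.sub →L[ℂ] S.subᗮ) × S.sub =>
    (γ (S.graph p.1) ⟨p.2 + p.1 p.2, S.add_mem_graph p.1 p.2⟩ : H)

namespace InvolutiveMorphism

/-- The like-Hermitian structure associated with `Ω`: `(x | y)_{S, S⁻*} = (x | γ_{S⁻*} y)` for `x`
in `S` and `y` in `S' = S⁻*`. -/
def pair (Ω : InvolutiveMorphism H) (S S' : Gr H) (_h : Ω.base S = S') (x : S.sub) (y : S'.sub) : ℂ :=
  ⟪(Ω.γ S' y : H), x⟫_ℂ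

/-- The kernel `Q_{ℋ,Ω}(S₁, S₂) = p_{S₁} ∘ γ_{S₂} : S₂ → S₁`. -/
def kernel (Ω : InvolutiveMorphism H) (S₁ S₂ : Gr H) : S₂.sub →L[ℂ] S₁.sub :=
  S₁.sub.orthogonalProjectionOnto.comp ((Ω.base S₂).sub.subtypeL.comp (Ω.γ S₂ : S₂.sub →L[ℂ] (Ω.base S₂).sub))

end InvolutiveMorphism

end Grassmannians

/-! ### The pull-back morphism -/

section PullBack

variable {B : Type*} [NormedAddCommGroup B] [NormedSpace ℝ B]
  {Z : Type*} [TopologicalSpace Z] [ChartedSpace B Z]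
  {E : Type*} [NormedAddCommGroup E] [NormedSpace ℂ E]
  {V : Z → Type*} [∀ z, AddCommGroup (V z)] [∀ z, Module ℂ (V z)] [∀ z, TopologicalSpace (V z)]
  [TopologicalSpace (TotalSpace E V)] [FiberBundle E V] [VectorBundle ℂ E V]
  {L : LikeHermitian B E V}

/-- An (algebraic) morphism `(δ, ζ)` from a like-Hermitian bundle into the tautological bundle with
the like-Hermitian structure of `Ω`: a fiberwise bounded linear map over `ζ`, where `ζ` respects the
involutions of the bases. No regularity of `δ` and `ζ` is included. -/
structure MorphismToTaut (L : LikeHermitian B E V) {H : Type*} [NormedAddCommGroup H]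
    [InnerProductSpace ℂ H] [CompleteSpace H] (Ω : InvolutiveMorphism H) where
  δ : TotalSpace E V → Taut H
  ζ : Z → Gr H
  fst_δ : ∀ ξ, (δ ξ).1.1 = ζ ξ.1
  linear_δ : ∀ s, ∃ T : V s →L[ℂ] H, ∀ ξ : V s, (δ ⟨s, ξ⟩).1.2 = T ξ
  ζ_invol : ∀ s, ζ (L.σ s) = Ω.base (ζ s)

namespace MorphismToTaut

variable {H : Type*} [NormedAddCommGroup H] [InnerProductSpace ℂ H] [CompleteSpace H]
  {Ω : InvolutiveMorphism H}

/-- The action of `δ` between the fibers over `s` and `ζ s`. -/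
def fiberMap (Δ : MorphismToTaut L Ω) (s : Z) (ξ : V s) : (Δ.ζ s).sub :=
  ⟨(Δ.δ ⟨s, ξ⟩).1.2, (Δ.fst_δ ⟨s, ξ⟩) ▸ (Δ.δ ⟨s, ξ⟩).2⟩

/-- `K` is the pull-back of `Q_{ℋ,Ω}` by `(δ, ζ)`, that is
`K(s,t) = (δ_{s⁻*})^{-*} ∘ Q(ζ s, ζ t) ∘ δ_t` where `(δ_{s⁻*})^{-*}` is the adjoint of `δ_{s⁻*}`
with respect to the pairings. -/
def IsPullBack (Δ : MorphismToTaut L Ω) (K : ReproducingKernel L) : Prop :=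
  ∀ (s t : Z) (η : V t) (ξ : V (L.σ s)),
    L.pair s (L.σ s) rfl (K.op s t η) ξ =
      Ω.pair (Δ.ζ s) (Δ.ζ (L.σ s)) (Δ.ζ_invol s).symm
        (Ω.kernel (Δ.ζ s) (Δ.ζ t) (Δ.fiberMap t η)) (Δ.fiberMap (L.σ s) ξ)

/-- A morphism is continuous if both of its maps are. -/
def IsContinuous (Δ : MorphismToTaut L Ω) : Prop := Continuous Δ.δ ∧ Continuous Δ.ζ

end MorphismToTaut

namespace ReproducingKernel

variable (K : ReproducingKernel L)

/-- `ζ_K(s)`, the closure of `K̂(D_s)` in `ℋ^K`. -/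
def zeta (s : Z) : Gr K.RKHS :=
  ⟨(LinearMap.range (K.hatFiber s : V s →ₗ[ℂ] K.RKHS)).topologicalClosure,
    Submodule.isClosed_topologicalClosure _⟩

theorem hat_mem_zeta (ξ : TotalSpace E V) : K.hat ξ ∈ (K.zeta ξ.1).sub :=
  Submodule.le_topologicalClosure _ ⟨ξ.2, rfl⟩

/-- The pull-back morphism `Δ_K = (δ_K, ζ_K)`, `δ_K(ξ) = (ζ_K(Π ξ), K_ξ)`. -/
def pullBackMorphism (Ω : InvolutiveMorphism K.RKHS)
    (hΩ : ∀ s, K.zeta (L.σ s) = Ω.base (K.zeta s)) : MorphismToTaut L Ω where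
  δ ξ := ⟨(K.zeta ξ.1, K.hat ξ), K.hat_mem_zeta ξ⟩
  ζ := K.zeta
  fst_δ _ := rfl
  linear_δ s := ⟨K.hatFiber s, fun _ => rfl⟩
  ζ_invol := hΩ

/-- The kernel is the pull-back of the universal one by `Δ_K`. -/
theorem pullBackMorphism_isPullBack (Ω : InvolutiveMorphism K.RKHS)
    (hΩ : ∀ s, K.zeta (L.σ s) = Ω.base (K.zeta s)) :
    (K.pullBackMorphism Ω hΩ).IsPullBack K := by
  have aux : ∀ (S S' : Gr K.RKHS) (_ : Ω.base S = S') (x : S'.sub), (Ω.γ S' x : K.RKHS) ∈ S.sub := by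
    rintro S _ rfl x
    simpa only [Ω.invol] using (Ω.γ (Ω.base S) x).2
  intro s t η ξ
  have key : ∀ (s' : Z) (_ : L.σ s = s') (ξ' : V s') (h : L.σ s = s'),
      L.pair s s' h (K.op s t η) ξ' = K.gram ⟨s', ξ'⟩ ⟨t, η⟩ := by
    intro s' hs ξ' h
    have : s = L.σ s' := by rw [← h, L.invol]
    subst this
    rfl
  rw [key _ rfl, ← K.inner_hat]
  simp only [InvolutiveMorphism.pair, InvolutiveMorphism.kernel]
  have h1 := aux (K.zeta s) (K.zeta (L.σ s)) (hΩ s).symm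
    ((K.pullBackMorphism Ω hΩ).fiberMap (L.σ s) ξ)
  refine (Ω.inner_γ _ _ ((K.pullBackMorphism Ω hΩ).fiberMap (L.σ s) ξ)
    ((K.pullBackMorphism Ω hΩ).fiberMap t η)).symm.trans ?_
  exact (Submodule.inner_orthogonalProjectionOnto_eq_of_mem_left
    (K := (K.zeta s).sub) ⟨_, h1⟩ _).symm

end ReproducingKernel

end PullBack

end LikeHermitianBundles

end

/-! Read in a local trivialization, `K̂` becomes a family of bounded operators `A s : E → ℋ^K`, and
everything follows from its norm continuity. The Gram form `⟪A s x, A t y⟫` is `(K(s⁻*, t) y | x)`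
in coordinates. `K` is norm continuous by assumption. The pairings are only known to be smooth as
scalar functions, but a jointly smooth family of bilinear maps is norm continuous
(`exists_continuousOn_bilinear`). Hence the Gram form is norm continuous in `(s, t)`, and so is `A`,
because `‖(A s - A s₀) x‖²` is a second difference of it (`continuousAt_of_continuousAt_inner`).

Continuity of `δ_K` follows by evaluating `A` at the fiber coordinate. For `ζ_K`, invertibility of
`K(s, s)` together with strong duality lets `ξ` be recovered boundedly from `K_ξ`
(`exists_leftInverse_hatFiber`), so `A s` is bounded below. Closed ranges of a norm-continuous
family vary continuously in the gap metric at such points (`Gr.continuousAt_of_range`). -/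

namespace LikeHermitianBundles

/-! ### Norm continuity of smooth bilinear families; second differences -/

section BilinearFamilies

variable {P E F G : Type*} [NormedAddCommGroup P] [NormedSpace ℝ P]
  [NormedAddCommGroup E] [NormedSpace ℝ E] [NormedAddCommGroup F] [NormedSpace ℝ F]
  [NormedAddCommGroup G] [NormedSpace ℝ G]

theorem fderiv_zero_apply_of_isLinearMap {f : E → F} (hf : IsLinearMap ℝ f) (hc : Continuous f)
    (x : E) : fderiv ℝ f 0 x = f x := by
  have h : f = (⟨hf.mk' f, hc⟩ : E →L[ℝ] F) := rfl
  rw [h, ContinuousLinearMap.fderiv]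

/-- A jointly smooth family of bilinear maps is continuous as a map into the bounded bilinear maps
with the operator norm. -/
theorem exists_continuousOn_bilinear {U : Set P} (hU : IsOpen U) {f : P → E → F → G}
    (hf : ContDiffOn ℝ ∞ (fun q : P × (E × F) => f q.1 q.2.1 q.2.2) (U ×ˢ univ))
    (hl : ∀ p ∈ U, ∀ y, IsLinearMap ℝ fun x => f p x y)
    (hr : ∀ p ∈ U, ∀ x, IsLinearMap ℝ (f p x)) :
    ∃ β : P → E →L[ℝ] F →L[ℝ] G, ContinuousOn β U ∧ ∀ p ∈ U, ∀ x y, β p x y = f p x y := by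
  have hf' (p : P) (hp : p ∈ U) (x : E) (y : F) :
      ContDiffAt ℝ ∞ (fun q : P × (E × F) => f q.1 q.2.1 q.2.2) (p, (x, y)) :=
    hf.contDiffAt ((hU.prod isOpen_univ).mem_nhds ⟨hp, mem_univ _⟩)
  -- A continuous linear map is its own derivative at `0`, and partial derivatives of a jointly
  -- smooth map are smooth in operator norm. Differentiating in `y`, then in `x`, upgrades pointwise
  -- to norm dependence; order `∞` absorbs the two lost derivatives.
  let g : P → E → F →L[ℝ] G := fun p x => fderiv ℝ (f p x) 0
  have hg (p : P) (hp : p ∈ U) (x : E) :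
      ContDiffAt ℝ ∞ (fun q : P × E => g q.1 q.2) (p, x) := by
    refine ContDiffAt.fderiv (f := fun q : P × E => f q.1 q.2) (g := fun _ => 0) (n := ∞) ?_
      contDiffAt_const le_rfl
    exact (hf' p hp x 0).comp (((p, x), 0) : (P × E) × F)
      ((contDiff_fst.fst.prodMk (contDiff_fst.snd.prodMk contDiff_snd)).contDiffAt)
  have hgv (p : P) (hp : p ∈ U) (x : E) (y : F) : g p x y = f p x y := by
    refine fderiv_zero_apply_of_isLinearMap (hr p hp x) ?_ y
    refine continuous_iff_continuousAt.2 fun y => ?_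
    exact (hf' p hp x y).continuousAt.comp
      (f := fun y : F => (p, (x, y))) (by fun_prop)
  refine ⟨fun p => fderiv ℝ (g p) 0, fun p hp => ?_, fun p hp x y => ?_⟩
  · refine (ContDiffAt.fderiv (f := g) (g := fun _ => 0) (n := ∞) (m := ∞) (hg p hp 0)
      contDiffAt_const le_rfl).continuousAt.continuousWithinAt
  · rw [fderiv_zero_apply_of_isLinearMap _ _ x, hgv p hp]
    · constructor
      · intro a b
        ext y
        simp only [add_apply, hgv p hp]
        exact (hl p hp y).map_add a b
      · intro c a
        ext y
        simp only [smul_apply, hgv p hp]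
        exact (hl p hp y).map_smul c a
    · refine continuous_iff_continuousAt.2 fun x => ?_
      exact (hg p hp x).continuousAt.comp (f := fun x : E => (p, x)) (by fun_prop)

/-- All four terms have the limit `g (s₀, s₀)` and cancel. When `g` is a Gram form of operators `A
s`, this combination measures the square of `A s - A s₀`. -/
theorem tendsto_norm_second_difference {X Z : Type*} [SeminormedAddCommGroup X]
    [TopologicalSpace Z] {g : Z × Z → X} {s₀ : Z} (hg : ContinuousAt g (s₀, s₀)) :
    Filter.Tendsto (fun s => ‖g (s, s) - g (s, s₀) - (g (s₀, s) - g (s₀, s₀))‖) (𝓝 s₀) (𝓝 0) := by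
  have hl {i j : Z → Z} (hi : Continuous i) (hj : Continuous j) (hi₀ : i s₀ = s₀)
      (hj₀ : j s₀ = s₀) : Filter.Tendsto (fun s => g (i s, j s)) (𝓝 s₀) (𝓝 (g (s₀, s₀))) := by
    have h : Filter.Tendsto (fun s => (i s, j s)) (𝓝 s₀) (𝓝 (s₀, s₀)) := by
      simpa [hi₀, hj₀] using (hi.prodMk hj).tendsto s₀
    exact hg.tendsto.comp h
  have h := (((hl continuous_id continuous_id rfl rfl).sub
    (hl continuous_id (continuous_const (y := s₀)) rfl rfl)).sub
    ((hl (continuous_const (y := s₀)) continuous_id rfl rfl).sub_const (g (s₀, s₀)))).norm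
  simpa using h

set_option synthInstance.maxHeartbeats 400000 in
theorem eventually_norm_second_difference_le {Z : Type*} [TopologicalSpace Z]
    {g : Z × Z → E →L[ℝ] F →L[ℝ] G} {s₀ : Z} (hg : ContinuousAt g (s₀, s₀)) {ε : ℝ} (hε : 0 < ε) :
    ∀ᶠ s in 𝓝 s₀, ∀ x y, ‖g (s, s) x y - g (s, s₀) x y - (g (s₀, s) x y - g (s₀, s₀) x y)‖ ≤
      ε * ‖x‖ * ‖y‖ := by
  filter_upwards [(tendsto_norm_second_difference (X := E →L[ℝ] F →L[ℝ] G) hg).eventually (gt_mem_nhds hε)] with s hs x y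
  refine le_trans ?_ (ContinuousLinearMap.le_of_opNorm₂_le_of_le _ hs.le le_rfl le_rfl)
  rfl

end BilinearFamilies

/-! ### Norm continuity of operators from their Gram forms -/

section OperatorFamilies

variable {H : Type*} [NormedAddCommGroup H] [InnerProductSpace ℂ H]
  {E : Type*} [NormedAddCommGroup E] [NormedSpace ℂ E]

/-- A family of operators `A s` is norm-continuous at `s₀` if the sesquilinear forms
`(x, y) ↦ ⟪A s x, A t y⟫` are norm-continuous in `(s, t)` at `(s₀, s₀)`. -/
theorem continuousAt_of_continuousAt_inner {Z : Type*} [TopologicalSpace Z] {A : Z → E →L[ℂ] H}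
    {G : Z × Z → E →L[ℝ] E →L[ℝ] ℂ} {s₀ : Z} (hG : ContinuousAt G (s₀, s₀)) {U : Set Z}
    (hU : U ∈ 𝓝 s₀) (hGA : ∀ s ∈ U, ∀ t ∈ U, ∀ x y, G (s, t) y x = ⟪A s x, A t y⟫_ℂ) :
    ContinuousAt A s₀ := by
  rw [Metric.continuousAt_iff']
  intro ε hε
  have hs₀ := mem_of_mem_nhds hU
  -- The second difference controls a squared norm, hence the square; the half leaves room for a
  -- strict inequality.
  have hδ : 0 < (ε / 2) ^ 2 := by positivity
  filter_upwards [hU, eventually_norm_second_difference_le hG hδ] with s hs hG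
  rw [dist_eq_norm]
  refine lt_of_le_of_lt ?_ (half_lt_self hε)
  refine ContinuousLinearMap.opNorm_le_bound _ (by positivity) fun x => ?_
  refine (sq_le_sq₀ (norm_nonneg _) (by positivity)).1 ?_
  have h0 : ‖(A s - A s₀) x‖ ^ 2 =
      (G (s, s) x x - G (s, s₀) x x - (G (s₀, s) x x - G (s₀, s₀) x x)).re := by
    rw [← inner_self_eq_norm_sq (𝕜 := ℂ), hGA s hs s hs, hGA s hs s₀ hs₀, hGA s₀ hs₀ s hs,
      hGA s₀ hs₀ s₀ hs₀, sub_apply, inner_sub_left, inner_sub_right, inner_sub_right]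
    simp only [RCLike.re_to_complex, Complex.sub_re]
  rw [h0]
  exact (Complex.re_le_norm _).trans ((hG x x).trans_eq (by ring))

end OperatorFamilies

/-! ### Gap estimates in the Grassmannian -/

section Gap

variable {H : Type*} [NormedAddCommGroup H] [InnerProductSpace ℂ H] [CompleteSpace H]

theorem Gr.norm_sub_proj_le (N : Gr H) (v : H) {w : H} (hw : w ∈ N.sub) :
    ‖v - N.proj v‖ ≤ ‖v - w‖ := by
  rw [Gr.proj, Submodule.starProjection_minimal]
  exact ciInf_le ⟨0, by rintro _ ⟨_, rfl⟩; positivity⟩ (⟨w, hw⟩ : N.sub)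

theorem Gr.norm_proj_sub_comp_le {M N : Gr H} {δ : ℝ} (hδ : 0 ≤ δ)
    (h : ∀ v ∈ M.sub, ‖v - N.proj v‖ ≤ δ * ‖v‖) : ‖M.proj - N.proj ∘L M.proj‖ ≤ δ := by
  refine ContinuousLinearMap.opNorm_le_bound _ hδ fun v => ?_
  refine (h (M.proj v) (Submodule.starProjection_apply_mem _ v)).trans ?_
  gcongr
  exact Submodule.norm_starProjection_apply_le _ v

/-- Write `p_M - p_N = (p_M - p_N p_M) - (p_N - p_N p_M)`. The first bracket is small by `h`; the
second is the adjoint of `p_N - p_M p_N`, which is small by `h'`. -/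
theorem Gr.norm_proj_sub_proj_le {M N : Gr H} {δ : ℝ} (hδ : 0 ≤ δ)
    (h : ∀ v ∈ M.sub, ‖v - N.proj v‖ ≤ δ * ‖v‖) (h' : ∀ v ∈ N.sub, ‖v - M.proj v‖ ≤ δ * ‖v‖) :
    ‖M.proj - N.proj‖ ≤ 2 * δ := by
  have h1 := norm_proj_sub_comp_le hδ h
  have h2 := norm_proj_sub_comp_le hδ h'
  have hM : star M.proj = M.proj := isSelfAdjoint_starProjection M.sub
  have hN : star N.proj = N.proj := isSelfAdjoint_starProjection N.sub
  have h3 : star (N.proj - M.proj ∘L N.proj) = N.proj - N.proj ∘L M.proj := by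
    change star (N.proj - M.proj * N.proj) = N.proj - N.proj * M.proj
    rw [star_sub, star_mul, hM, hN]
  rw [← norm_star, h3] at h2
  calc ‖M.proj - N.proj‖
      = ‖(M.proj - N.proj ∘L M.proj) - (N.proj - N.proj ∘L M.proj)‖ := by
        rw [sub_sub_sub_cancel_right]
    _ ≤ 2 * δ := (norm_sub_le _ _).trans (by linarith)

variable {E : Type*} [NormedAddCommGroup E] [NormedSpace ℂ E]

/-- The point `A' x` of `N` lies within `‖A - A'‖ ‖x‖` of `A x`, and the lower bound trades `‖x‖`
for `‖A x‖ / c`. The resulting inequality is a closed condition, so it passes to the closure of the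
range. -/
theorem Gr.norm_sub_proj_le_of_range {M N : Gr H} {A A' : E →L[ℂ] H} {c : ℝ} (hc : 0 < c)
    (hA : ∀ x, c * ‖x‖ ≤ ‖A x‖) (hM : (M.sub : Set H) = closure (range A))
    (hN : ∀ x, A' x ∈ N.sub) : ∀ v ∈ M.sub, ‖v - N.proj v‖ ≤ ‖A - A'‖ / c * ‖v‖ := by
  intro v hv
  rw [← SetLike.mem_coe, hM] at hv
  refine closure_minimal (t := {v | ‖v - N.proj v‖ ≤ ‖A - A'‖ / c * ‖v‖}) ?_
    (isClosed_le (by fun_prop) (by fun_prop)) hv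
  rintro _ ⟨x, rfl⟩
  calc ‖A x - N.proj (A x)‖ ≤ ‖(A - A') x‖ := N.norm_sub_proj_le _ (hN x)
    _ ≤ ‖A - A'‖ * ‖x‖ := (A - A').le_opNorm x
    _ ≤ ‖A - A'‖ * (‖A x‖ / c) := by
      gcongr
      rw [le_div_iff₀ hc, mul_comm]
      exact hA x
    _ = ‖A - A'‖ / c * ‖A x‖ := by ring

/-- The closed range of a norm-continuous family of operators is continuous in the Grassmannian at
the points where the operator is bounded below. -/
theorem Gr.continuousAt_of_range {Z : Type*} [TopologicalSpace Z] {F : Z → Gr H}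
    {A : Z → E →L[ℂ] H} {s₀ : Z} {c : ℝ} (hc : 0 < c) (hA : ∀ x, c * ‖x‖ ≤ ‖A s₀ x‖)
    (hcont : ContinuousAt A s₀)
    (hF : ∀ᶠ s in 𝓝 s₀, ((F s).sub : Set H) = closure (range (A s))) : ContinuousAt F s₀ := by
  have hn : Filter.Tendsto (fun s => ‖A s - A s₀‖) (𝓝 s₀) (𝓝 0) :=
    tendsto_iff_norm_sub_tendsto_zero.1 hcont
  rw [ContinuousAt, nhds_induced, Filter.tendsto_comap_iff, tendsto_iff_norm_sub_tendsto_zero]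
  have hlim : Filter.Tendsto (fun s => 2 * (‖A s - A s₀‖ / (c / 2))) (𝓝 s₀) (𝓝 0) := by
    simpa using (hn.div_const (c / 2)).const_mul 2
  refine squeeze_zero' (.of_forall fun _ => norm_nonneg _) ?_ hlim
  have hF₀ := hF.self_of_nhds
  have hc2 : 0 < c / 2 := by positivity
  -- Within distance `c / 2` of `A s₀` the operator `A s` is still bounded below by `c / 2`, so this
  -- constant serves both one-sided gap estimates.
  filter_upwards [hF, hn.eventually (gt_mem_nhds hc2)] with s hs hlt
  refine norm_proj_sub_proj_le (by positivity) ?_ ?_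
  · refine norm_sub_proj_le_of_range hc2 (fun x => ?_) hs fun x => ?_
    · have h1 := norm_sub_norm_le (A s₀ x) (A s x)
      have h2 := (A s - A s₀).le_opNorm x
      rw [sub_apply, norm_sub_rev] at h2
      have h3 := mul_le_mul_of_nonneg_right hlt.le (norm_nonneg x)
      linarith [hA x]
    · rw [← SetLike.mem_coe, hF₀]
      exact subset_closure (mem_range_self x)
  · rw [norm_sub_rev]
    refine norm_sub_proj_le_of_range hc2 (fun x => ?_) hF₀ fun x => ?_
    · have := mul_nonneg hc.le (norm_nonneg x)
      linarith [hA x]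
    · rw [← SetLike.mem_coe, hs]
      exact subset_closure (mem_range_self x)

end Gap

/-! ### The map `K̂` in local trivializations and continuity of `Δ_K` -/

section HatFiber

variable {B : Type*} [NormedAddCommGroup B] [NormedSpace ℝ B]
  {Z : Type*} [TopologicalSpace Z] [ChartedSpace B Z]
  {E : Type*} [NormedAddCommGroup E] [NormedSpace ℂ E]
  {V : Z → Type*} [∀ z, AddCommGroup (V z)] [∀ z, Module ℂ (V z)] [∀ z, TopologicalSpace (V z)]
  [TopologicalSpace (TotalSpace E V)] [FiberBundle E V] [VectorBundle ℂ E V]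

/-- In local trivializations, the pairings depend continuously on the point with respect to the
operator norm on bounded `ℝ`-bilinear maps. -/
theorem LikeHermitian.exists_continuousAt_pair [IsManifold 𝓘(ℝ, B) ∞ Z] (L : LikeHermitian B E V)
    (e e' : Trivialization E (TotalSpace.proj : TotalSpace E V → Z))
    [MemTrivializationAtlas e] [MemTrivializationAtlas e'] {z₀ : Z} (hz : z₀ ∈ e.baseSet)
    (hz' : L.σ z₀ ∈ e'.baseSet) :
    ∃ β : Z → E →L[ℝ] E →L[ℝ] ℂ, ContinuousAt β z₀ ∧ ∀ᶠ z in 𝓝 z₀, ∀ x y,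
      β z x y = L.pair z (L.σ z) rfl (e.symm z x) (e'.symm (L.σ z) y) := by
  -- The derivative argument needs a normed parameter space, so the base point is moved into a
  -- chart.
  let φ := chartAt B z₀
  have hz₀ : z₀ ∈ φ.source := mem_chart_source B z₀
  let W : Set Z := e.baseSet ∩ L.σ ⁻¹' e'.baseSet
  have hW : IsOpen W := e.open_baseSet.inter (e'.open_baseSet.preimage L.smooth_σ.continuous)
  let U : Set B := φ.target ∩ φ.symm ⁻¹' W
  have hU : IsOpen U := φ.isOpen_inter_preimage_symm hW
  let f : B → E → E → ℂ := fun b x y =>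
    L.pair (φ.symm b) (L.σ (φ.symm b)) rfl (e.symm (φ.symm b) x) (e'.symm (L.σ (φ.symm b)) y)
  have hf : ContDiffOn ℝ ∞ (fun q : B × (E × E) => f q.1 q.2.1 q.2.2) (U ×ˢ univ) := by
    rw [← contMDiffOn_iff_contDiffOn, modelWithCornersSelf_prod, ← chartedSpaceSelf_prod]
    have h1 : ContMDiffOn (𝓘(ℝ, B).prod 𝓘(ℝ, E × E)) (𝓘(ℝ, B).prod 𝓘(ℝ, E × E)) ∞
        (fun q : B × (E × E) => (φ.symm q.1, q.2)) (U ×ˢ univ) := by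
      refine ContMDiffOn.prodMk ?_ contMDiffOn_snd
      exact (contMDiffOn_chart_symm (I := 𝓘(ℝ, B)) (n := ∞)).comp contMDiffOn_fst
        fun q hq => hq.1.1
    exact (L.smooth_pair e e').comp h1 fun q hq => ⟨hq.1.2, mem_univ _⟩
  -- The maps `e.symm` are known to be linear over the base sets, where they agree with `symmL`.
  -- Real scalars are handled as complex ones; conjugation fixes them, so the antilinear slot is
  -- real linear too.
  obtain ⟨β, hβ, hβf⟩ := exists_continuousOn_bilinear hU hf
    (fun b hb y => by
      have hb1 := hb.2.1
      constructor <;> intros <;>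
        simp [f, ← e.symmL_apply (R := ℂ) hb1, ← Complex.coe_smul])
    (fun b hb x => by
      have hb2 : L.σ (φ.symm b) ∈ e'.baseSet := hb.2.2
      constructor <;> intros <;>
        simp [f, ← e'.symmL_apply (R := ℂ) hb2, ← Complex.coe_smul])
  have hφU : φ z₀ ∈ U := ⟨φ.map_source hz₀, by simpa [W, φ.left_inv hz₀] using ⟨hz, hz'⟩⟩
  refine ⟨fun z => β (φ z),
    (hβ.continuousAt (hU.mem_nhds hφU)).comp (φ.continuousAt hz₀), ?_⟩
  filter_upwards [φ.open_source.mem_nhds hz₀, hW.mem_nhds ⟨hz, hz'⟩] with z hzs hzW x y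
  have hzU : φ z ∈ U := ⟨φ.map_source hzs, by simpa [φ.left_inv hzs] using hzW⟩
  rw [hβf _ hzU]
  simp only [f]
  rw [φ.left_inv hzs]

namespace ReproducingKernel

variable {L : LikeHermitian B E V} (K : ReproducingKernel L)

/-- Allows `z` to be any point equal to `s⁻*`, so that `s⁻*` and its double image can be used
without transport between fibers. -/
theorem gram_eq_pair {z s : Z} (h : L.σ z = s) (h' : L.σ s = z) (ξ : V s) (η : TotalSpace E V) :
    K.gram ⟨s, ξ⟩ η = L.pair z s h (K.op z η.1 η.2) ξ := by
  subst h'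
  rfl

theorem inner_hatFiber (s t : Z) (ξ : V s) (η : V t) :
    ⟪K.hatFiber s ξ, K.hatFiber t η⟫_ℂ = K.gram ⟨s, ξ⟩ ⟨t, η⟩ := K.inner_hat _ _

/-- In a local trivialization, `K̂` is continuous as an operator-valued map. -/
theorem continuousAt_hatFiber_comp_symmL [IsManifold 𝓘(ℝ, B) ∞ Z] (hK : K.IsContinuous)
    (e : Trivialization E (TotalSpace.proj : TotalSpace E V → Z)) [MemTrivializationAtlas e]
    {s₀ : Z} (hs₀ : s₀ ∈ e.baseSet) :
    ContinuousAt (fun s => (K.hatFiber s).comp (e.symmL ℂ s)) s₀ := by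
  let z₀ := L.σ s₀
  let e' := trivializationAt E V z₀
  have hz₀ : z₀ ∈ e'.baseSet := FiberBundle.mem_baseSet_trivializationAt' z₀
  have hσ : Continuous L.σ := L.smooth_σ.continuous
  obtain ⟨β, hβc, hβ⟩ := L.exists_continuousAt_pair e' e hz₀ (by simpa [z₀, L.invol] using hs₀)
  let k : Z × Z → E →L[ℂ] E := fun p =>
    ((e'.continuousLinearMapAt ℂ p.1).comp (K.op p.1 p.2)).comp (e.symmL ℂ p.2)
  have hkc : ContinuousAt k (z₀, s₀) := (hK e' e).continuousAt
    ((e'.open_baseSet.prod e.open_baseSet).mem_nhds ⟨hz₀, hs₀⟩)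
  let R := ContinuousLinearMap.restrictScalarsL ℂ E E ℝ ℝ
  -- The form `(K(s⁻*, t) y | x)` in coordinates: `e` serves the fibers over `s` and `t` near `s₀`,
  -- and `e'` the fiber over `s⁻*` near `s₀⁻*`. It is real bilinear because the pairing is
  -- antilinear in `x`.
  let G : Z × Z → E →L[ℝ] E →L[ℝ] ℂ := fun p => (β (L.σ p.1)).comp (R (k (L.σ p.1, p.2)))
  have hG : ContinuousAt G (s₀, s₀) := by
    have h1 : ContinuousAt (fun p : Z × Z => β (L.σ p.1)) (s₀, s₀) :=
      ContinuousAt.comp (x := (s₀, s₀)) (g := β) (f := fun p : Z × Z => L.σ p.1) hβc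
        (by fun_prop)
    have h2 : ContinuousAt (fun p : Z × Z => k (L.σ p.1, p.2)) (s₀, s₀) :=
      ContinuousAt.comp (x := (s₀, s₀)) (g := k) (f := fun p : Z × Z => (L.σ p.1, p.2)) hkc
        (by fun_prop)
    exact h1.clm_comp (R.continuous.continuousAt.comp h2)
  have hU : ∀ᶠ s in 𝓝 s₀, ∀ t x y,
      G (s, t) y x = K.gram ⟨s, e.symmL ℂ s x⟩ ⟨t, e.symmL ℂ t y⟩ := by
    filter_upwards [hσ.continuousAt.eventually hβ, e.open_baseSet.mem_nhds hs₀,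
      (e'.open_baseSet.preimage hσ).mem_nhds hz₀] with s hs hse hse'
    intro t x y
    change β (L.σ s) (k (L.σ s, t) y) x = _
    -- The pairing obtained from `β` lives over `σ (σ s)`; generalizing this point to `w` lets it be
    -- replaced by `s`.
    have key : ∀ (w : Z) (h : L.σ (L.σ s) = w), L.pair (L.σ s) (L.σ (L.σ s)) rfl
        (e'.symm (L.σ s) (k (L.σ s, t) y)) (e.symm (L.σ (L.σ s)) x) =
        L.pair (L.σ s) w h (e'.symm (L.σ s) (k (L.σ s, t) y)) (e.symm w x) := by
      rintro w rfl
      rfl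
    rw [hs, key s (L.invol s), K.gram_eq_pair (L.invol s) rfl, e.symmL_apply hse,
      ← e'.symmL_apply (R := ℂ) hse']
    simp only [k, ContinuousLinearMap.comp_apply]
    rw [e'.symmL_continuousLinearMapAt hse']
  exact continuousAt_of_continuousAt_inner hG hU fun s hs t _ x y =>
    (hs t x y).trans (K.inner_hatFiber s t _ _).symm

/-- If `K(s,s)` is invertible, then `K̂` is bounded below on the fiber over `s`: it has a bounded
left inverse. -/
theorem exists_leftInverse_hatFiber (s : Z) (hs : (K.op s s).IsInvertible) :
    ∃ T : K.RKHS →L[ℂ] V s, ∀ ξ, T (K.hatFiber s ξ) = ξ := by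
  obtain ⟨M, hM⟩ := hs
  obtain ⟨P, hP⟩ := (L.strong s (L.σ s) rfl).left_iso
  -- `J h` is the antilinear functional `η ↦ ⟪K_η, h⟫` on the fiber over `s⁻*`. At `h = K_ξ` it is
  -- `(K(s, s) ξ | ·)`, so inverting the duality `P` and then `M = K(s, s)` returns `ξ`.
  let J : K.RKHS →L[ℂ] (V (L.σ s) →L⋆[ℂ] ℂ) :=
    (ContinuousLinearMap.precomp (τ := starRingEnd ℂ) (ρ := starRingEnd ℂ) ℂ
      (K.hatFiber (L.σ s))).comp (innerSLFlip ℂ)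
  have hJ (ξ : V s) : J (K.hatFiber s ξ) = P (M ξ) := by
    ext η
    rw [hP, ← ContinuousLinearEquiv.coe_coe, hM]
    change ⟪K.hatFiber (L.σ s) η, K.hatFiber s ξ⟫_ℂ = _
    rw [K.inner_hatFiber, K.gram_eq_pair rfl (L.invol s)]
  refine ⟨(M.symm : V s →L[ℂ] V s).comp ((P.symm : _ →L[ℂ] V s).comp J), fun ξ => ?_⟩
  simp [hJ]

theorem exists_le_norm_hatFiber_symmL (e : Trivialization E (TotalSpace.proj : TotalSpace E V → Z))
    [MemTrivializationAtlas e] {s : Z} (he : s ∈ e.baseSet) (hs : (K.op s s).IsInvertible) :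
    ∃ c > 0, ∀ x, c * ‖x‖ ≤ ‖(K.hatFiber s).comp (e.symmL ℂ s) x‖ := by
  obtain ⟨T, hT⟩ := K.exists_leftInverse_hatFiber s hs
  let S : K.RKHS →L[ℂ] E := (e.continuousLinearMapAt ℂ s).comp T
  -- The summand `1` keeps the constant positive even if `S = 0`.
  refine ⟨(‖S‖ + 1)⁻¹, by positivity, fun x => ?_⟩
  rw [inv_mul_le_iff₀ (by positivity)]
  have hS : S ((K.hatFiber s).comp (e.symmL ℂ s) x) = x := by
    simp [S, hT, e.continuousLinearMapAt_symmL he]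
  calc ‖x‖ = ‖S ((K.hatFiber s).comp (e.symmL ℂ s) x)‖ := by rw [hS]
    _ ≤ ‖S‖ * ‖(K.hatFiber s).comp (e.symmL ℂ s) x‖ := S.le_opNorm _
    _ ≤ _ := by gcongr; linarith

theorem zeta_sub_eq_closure (e : Trivialization E (TotalSpace.proj : TotalSpace E V → Z))
    [MemTrivializationAtlas e] {s : Z} (he : s ∈ e.baseSet) :
    ((K.zeta s).sub : Set K.RKHS) = closure (range ((K.hatFiber s).comp (e.symmL ℂ s))) := by
  have hsurj : Function.Surjective (e.symmL ℂ s) := fun y =>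
    ⟨_, e.symmL_continuousLinearMapAt he y⟩
  have : range ((K.hatFiber s).comp (e.symmL ℂ s)) = range (K.hatFiber s) :=
    hsurj.range_comp (K.hatFiber s)
  rw [this]
  rfl

/-- Continuity at `s` uses a lower bound for `K̂` only on the fiber over `s`; norm continuity in the
trivialization spreads it to nearby fibers. -/
theorem continuous_zeta [IsManifold 𝓘(ℝ, B) ∞ Z] (hK : K.IsContinuous)
    (hinv : ∀ s, (K.op s s).IsInvertible) : Continuous K.zeta := by
  refine continuous_iff_continuousAt.2 fun s => ?_
  let e := trivializationAt E V s
  have he : s ∈ e.baseSet := FiberBundle.mem_baseSet_trivializationAt' s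
  obtain ⟨c, hc, hcs⟩ := K.exists_le_norm_hatFiber_symmL e he (hinv s)
  refine Gr.continuousAt_of_range hc hcs (K.continuousAt_hatFiber_comp_symmL hK e he) ?_
  filter_upwards [e.open_baseSet.mem_nhds he] with t ht
  exact K.zeta_sub_eq_closure e ht

/-- Locally `K_ξ` is the operator `A (Π ξ)` applied to the fiber coordinate of `ξ`, and evaluation
is jointly continuous for the operator norm. -/
theorem continuous_hat [IsManifold 𝓘(ℝ, B) ∞ Z] (hK : K.IsContinuous) : Continuous K.hat := by
  refine continuous_iff_continuousAt.2 fun ξ₀ => ?_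
  let e := trivializationAt E V ξ₀.proj
  have he : ξ₀.proj ∈ e.baseSet := FiberBundle.mem_baseSet_trivializationAt' ξ₀.proj
  have hπ : Continuous (TotalSpace.proj : TotalSpace E V → Z) := FiberBundle.continuous_proj E V
  have h1 : ContinuousAt
      (fun ξ : TotalSpace E V => (K.hatFiber ξ.proj).comp (e.symmL ℂ ξ.proj)) ξ₀ :=
    ContinuousAt.comp (f := TotalSpace.proj)
      (g := fun s => (K.hatFiber s).comp (e.symmL ℂ s))
      (K.continuousAt_hatFiber_comp_symmL hK e he) hπ.continuousAt
  have h2 : ContinuousAt (fun ξ : TotalSpace E V => (e ξ).2) ξ₀ :=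
    continuousAt_snd.comp (e.continuousAt (e.mem_source.2 he))
  refine (h1.clm_apply h2).congr ?_
  filter_upwards [(e.open_baseSet.preimage hπ).mem_nhds he] with ξ hξ
  have h3 : e.symmL ℂ ξ.proj (e ξ).2 = ξ.2 := by
    have := e.symmL_continuousLinearMapAt (R := ℂ) hξ ξ.2
    rwa [e.continuousLinearMapAt_apply_of_mem ℂ hξ] at this
  rw [ContinuousLinearMap.comp_apply, h3]
  rfl

end ReproducingKernel

end HatFiber

end LikeHermitianBundles

open LikeHermitianBundles in
theorem theorem5p8
    {B : Type*} [NormedAddCommGroup B] [NormedSpace ℝ B] [CompleteSpace B]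
    {Z : Type*} [TopologicalSpace Z] [ChartedSpace B Z] [IsManifold 𝓘(ℝ, B) ∞ Z]
    {E : Type*} [NormedAddCommGroup E] [NormedSpace ℂ E] [CompleteSpace E]
    {V : Z → Type*} [∀ z, AddCommGroup (V z)] [∀ z, Module ℂ (V z)] [∀ z, TopologicalSpace (V z)]
    [TopologicalSpace (TotalSpace E V)] [FiberBundle E V] [VectorBundle ℂ E V]
    [SmoothComplexVectorBundle B E V]
    (L : LikeHermitian B E V) (K : ReproducingKernel L)
    (Ω : InvolutiveMorphism K.RKHS) (hΩ : ∀ s, K.zeta (L.σ s) = Ω.base (K.zeta s))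
    (hK : K.IsContinuous)
    (hinv : ∀ s, (K.op s s).IsInvertible)
    (hsim : LocallySimilar K.zeta) :
    (K.pullBackMorphism Ω hΩ).IsContinuous := by
  have hz := K.continuous_zeta hK hinv
  exact ⟨((hz.comp (FiberBundle.continuous_proj E V)).prodMk (K.continuous_hat hK)).subtype_mk _, hz⟩
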